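/- Theorem 4.1. A separable (not necessarily unital) C$^*$-algebra $\mathcal A$ is called an MF algebra if there are positive integers $n_1,n_2,\ldots$ and an embedding (an injective $*$-homomorphism, not required to be unital) of $\mathcal A$ into $\prod_k \mathcal M_{n_k}(\mathbb C)/\sum_k \mathcal M_{n_k}(\mathbb C)$, where $\prod_k \mathcal M_{n_k}(\mathbb C)$ is the C$^*$-algebra of all sequences $\langle x_k\rangle$ with $x_k\in\mathcal M_{n_k}(\mathbb C)$ and $\sup_k\|x_k\|<\infty$ (operator norms), and $\sum_k \mathcal M_{n_k}(\mathbb C)$ is the closed two-sided ideal of those sequences with $\limsup_{k\to\infty}\|x_k\|=0$. Let $\mathcal A$ be an MF algebra, let $G$ be a finite group, and let $\alpha: G\to \mathrm{Aut}(\mathcal A)$ be a homomorphism into the group of $*$-automorphisms of $\mathcal A$. Then the crossed product $\mathcal A\rtimes_\alpha G$ is an MF algebra. Here $\mathcal A\rtimes_\alpha G$ is the $*$-algebra of all functions $f:G\to\mathcal A$ with $(f*g)(s)=\sum_{t\in G} f(t)\,\alpha_t(g(t^{-1}s))$ and $f^*(s)=\alpha_s(f(s^{-1})^*)$, with the full crossed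 product norm (the largest C$^*$-seminorm bounded by the norm $f\mapsto\sum_{s\in G}\|f(s)\|$), which coincides with the reduced one, as $G$ is finite. -/

import Mathlib

open scoped ENNReal
open Filter Topology

noncomputable section

/-! ### The corona algebra of a sequence of C⋆-algebras -/

section Corona

variable (A : ℕ → Type*) [∀ k, NonUnitalCStarAlgebra (A k)]

/-- The sequences `⟨x_k⟩` in the direct product `∏ₖ A k` (all bounded sequences, with the sup
norm: this is `lp A ∞`) with `limsup ‖x_k‖ = 0`. -/
def nullSequences : Submodule ℂ (lp A ∞) where
  carrier := {x | Tendsto (fun k => ‖x k‖) atTop (𝓝 0)}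
  zero_mem' := by simp
  add_mem' {x y} hx hy := by
    refine squeeze_zero (fun k => norm_nonneg _) (fun k => ?_) (by simpa using hx.add hy)
    exact norm_add_le (x k) (y k)
  smul_mem' c x hx := by
    refine squeeze_zero (fun k => norm_nonneg _) (fun k => ?_) (by simpa using hx.const_mul ‖c‖)
    exact (norm_smul c (x k)).le

/-- The quotient `∏ₖ A k / ∑ₖ A k` of the bounded sequences by the null sequences. -/
def Corona : Type _ := lp A ∞ ⧸ nullSequences A

variable {A}

theorem mem_nullSequences {x : lp A ∞} :
    x ∈ nullSequences A ↔ Tendsto (fun k => ‖x k‖) atTop (𝓝 0) := Iff.rfl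

theorem nullSequences_mul_left (x : lp A ∞) {y : lp A ∞} (hy : y ∈ nullSequences A) :
    x * y ∈ nullSequences A := by
  rw [mem_nullSequences] at hy ⊢
  refine squeeze_zero (fun k => norm_nonneg _) (fun k => ?_) (by simpa using hy.const_mul ‖x‖)
  calc ‖(x * y) k‖ ≤ ‖x k‖ * ‖y k‖ := norm_mul_le (x k) (y k)
    _ ≤ ‖x‖ * ‖y k‖ := by
      gcongr
      exact lp.norm_apply_le_norm ENNReal.top_ne_zero x k

theorem nullSequences_star {x : lp A ∞} (hx : x ∈ nullSequences A) :
    star x ∈ nullSequences A := by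
  rw [mem_nullSequences] at hx ⊢
  simpa using hx

theorem nullSequences_mul_right {x : lp A ∞} (y : lp A ∞) (hx : x ∈ nullSequences A) :
    x * y ∈ nullSequences A := by
  simpa using nullSequences_star (nullSequences_mul_left (star y) (nullSequences_star hx))

variable (A) in
theorem isClosed_nullSequences : IsClosed (nullSequences A : Set (lp A ∞)) := by
  refine isClosed_of_closure_subset fun x hx => ?_
  rw [SetLike.mem_coe, mem_nullSequences, Metric.tendsto_atTop]
  intro ε hε
  obtain ⟨y, hy, hxy⟩ := Metric.mem_closure_iff.1 hx (ε / 2) (half_pos hε)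
  obtain ⟨N, hN⟩ := Metric.tendsto_atTop.1 (mem_nullSequences.1 hy) (ε / 2) (half_pos hε)
  refine ⟨N, fun k hk => ?_⟩
  have h1 := hN k hk
  have h2 : ‖x k - y k‖ ≤ ‖x - y‖ := lp.norm_apply_le_norm ENNReal.top_ne_zero (x - y) k
  have h3 : ‖x k‖ ≤ ‖x k - y k‖ + ‖y k‖ := by simpa using norm_add_le (x k - y k) (y k)
  rw [dist_eq_norm] at hxy
  rw [Real.dist_eq, sub_zero, abs_norm] at h1 ⊢
  linarith

instance : IsClosed (nullSequences A : Set (lp A ∞)) := isClosed_nullSequences A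

namespace Corona

instance : NormedAddCommGroup (Corona A) :=
  inferInstanceAs (NormedAddCommGroup (lp A ∞ ⧸ nullSequences A))

instance : NormedSpace ℂ (Corona A) :=
  inferInstanceAs (NormedSpace ℂ (lp A ∞ ⧸ nullSequences A))

instance : CompleteSpace (Corona A) :=
  inferInstanceAs (CompleteSpace (lp A ∞ ⧸ nullSequences A))

variable (A) in
/-- The canonical quotient map `∏ₖ A k → ∏ₖ A k / ∑ₖ A k`. -/
def mk : lp A ∞ →ₗ[ℂ] Corona A := (nullSequences A).mkQ

theorem mk_surjective : Function.Surjective (mk A) := (nullSequences A).mkQ_surjective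

theorem mk_eq_mk {x y : lp A ∞} : mk A x = mk A y ↔ x - y ∈ nullSequences A :=
  Submodule.Quotient.eq (nullSequences A)

theorem norm_mk_le (x : lp A ∞) : ‖mk A x‖ ≤ ‖x‖ :=
  Submodule.Quotient.norm_mk_le (S := nullSequences A) x

theorem exists_norm_lt (X : Corona A) {ε : ℝ} (hε : 0 < ε) :
    ∃ x, mk A x = X ∧ ‖x‖ < ‖X‖ + ε :=
  Submodule.Quotient.norm_mk_lt (S := nullSequences A) X hε

instance : Mul (Corona A) where
  mul := Quotient.map₂ (· * ·) fun x x' hx y y' hy => by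
    have hx' : x - x' ∈ nullSequences A := (nullSequences A).quotientRel_def.1 hx
    have hy' : y - y' ∈ nullSequences A := (nullSequences A).quotientRel_def.1 hy
    refine (nullSequences A).quotientRel_def.2 ?_
    have : x * y - x' * y' = (x - x') * y + x' * (y - y') := by noncomm_ring
    rw [this]
    exact add_mem (nullSequences_mul_right y hx') (nullSequences_mul_left x' hy')

instance : Star (Corona A) where
  star := Quotient.map star fun x x' hx => by
    have hx' : x - x' ∈ nullSequences A := (nullSequences A).quotientRel_def.1 hx
    refine (nullSequences A).quotientRel_def.2 ?_
    rw [← star_sub]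
    exact nullSequences_star hx'

theorem mk_mul (x y : lp A ∞) : mk A (x * y) = mk A x * mk A y := rfl

theorem mk_star (x : lp A ∞) : mk A (star x) = star (mk A x) := rfl

instance : NonUnitalRing (Corona A) :=
  { (inferInstance : AddCommGroup (Corona A)),
    mk_surjective.nonUnitalRing (mk A) (map_zero _) (map_add _) mk_mul (map_neg _) (map_sub _)
      (fun n x => map_nsmul (mk A) n x) (fun n x => map_zsmul (mk A) n x) with }

instance : StarRing (Corona A) where
  star_involutive X := by
    obtain ⟨x, rfl⟩ := mk_surjective X
    rw [← mk_star, ← mk_star, star_star]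
  star_mul X Y := by
    obtain ⟨x, rfl⟩ := mk_surjective X
    obtain ⟨y, rfl⟩ := mk_surjective Y
    rw [← mk_mul, ← mk_star, star_mul, mk_mul, mk_star, mk_star]
  star_add X Y := by
    obtain ⟨x, rfl⟩ := mk_surjective X
    obtain ⟨y, rfl⟩ := mk_surjective Y
    rw [← map_add, ← mk_star, star_add, map_add, mk_star, mk_star]

instance : StarModule ℂ (Corona A) where
  star_smul c X := by
    obtain ⟨x, rfl⟩ := mk_surjective X
    rw [← map_smul, ← mk_star, star_smul, map_smul, mk_star]

instance : IsScalarTower ℂ (Corona A) (Corona A) where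
  smul_assoc c X Y := by
    obtain ⟨x, rfl⟩ := mk_surjective X
    obtain ⟨y, rfl⟩ := mk_surjective Y
    simp only [smul_eq_mul, ← map_smul, ← mk_mul, smul_mul_assoc]

instance : SMulCommClass ℂ (Corona A) (Corona A) where
  smul_comm c X Y := by
    obtain ⟨x, rfl⟩ := mk_surjective X
    obtain ⟨y, rfl⟩ := mk_surjective Y
    simp only [smul_eq_mul, ← map_smul, ← mk_mul, mul_smul_comm]

instance : NonUnitalNormedRing (Corona A) where
  dist_eq := NormedAddCommGroup.dist_eq
  norm_mul_le X Y := by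
    refine le_of_forall_pos_le_add fun ε hε => ?_
    have hc : Tendsto (fun δ : ℝ => (‖X‖ + δ) * (‖Y‖ + δ)) (𝓝[>] 0) (𝓝 (‖X‖ * ‖Y‖)) := by
      have : Continuous fun δ : ℝ => (‖X‖ + δ) * (‖Y‖ + δ) := by fun_prop
      simpa using (this.tendsto 0).mono_left nhdsWithin_le_nhds
    obtain ⟨δ, hδ, hδ0⟩ := ((hc.eventually (gt_mem_nhds (lt_add_of_pos_right _ hε))).and
      self_mem_nhdsWithin).exists
    obtain ⟨x, rfl, hx⟩ := exists_norm_lt X hδ0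
    obtain ⟨y, rfl, hy⟩ := exists_norm_lt Y hδ0
    calc ‖mk A x * mk A y‖ ≤ ‖x * y‖ := by rw [← mk_mul]; exact norm_mk_le _
      _ ≤ ‖x‖ * ‖y‖ := norm_mul_le x y
      _ ≤ (‖mk A x‖ + δ) * (‖mk A y‖ + δ) := by gcongr
      _ ≤ _ := hδ.le

theorem norm_mk_le_of_eventually {x : lp A ∞} {r : ℝ} (hr : 0 ≤ r)
    (h : ∀ᶠ k in atTop, ‖x k‖ ≤ r) : ‖mk A x‖ ≤ r := by
  classical
  obtain ⟨N, hN⟩ := eventually_atTop.1 h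
  let y : ∀ k, A k := fun k => if k < N then 0 else x k
  have hy : ∀ k, ‖y k‖ ≤ r := fun k => by
    by_cases hk : k < N
    · simpa [y, hk] using hr
    · simpa [y, hk] using hN k (not_lt.1 hk)
  let y' : lp A ∞ := ⟨y, memℓp_infty ⟨r, by rintro _ ⟨k, rfl⟩; exact hy k⟩⟩
  have hxy : mk A x = mk A y' := by
    rw [mk_eq_mk, mem_nullSequences]
    refine tendsto_const_nhds.congr' ?_
    filter_upwards [eventually_ge_atTop N] with k hk
    have : (x - y') k = x k - y k := rfl
    simp [this, y, not_lt.2 hk]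
  rw [hxy]
  exact (norm_mk_le y').trans (lp.norm_le_of_forall_le hr hy)

instance : CStarRing (Corona A) where
  norm_mul_self_le X := by
    refine le_of_forall_pos_le_add fun ε hε => ?_
    obtain ⟨x, rfl⟩ := mk_surjective X
    obtain ⟨z, hz, hzn⟩ := exists_norm_lt (star (mk A x) * mk A x) (half_pos hε)
    rw [← mk_star, ← mk_mul] at hz hzn ⊢
    set s := ‖mk A (star x * x)‖ with hs
    have hs0 : 0 ≤ s := norm_nonneg _
    have hlt := (mem_nullSequences.1 (mk_eq_mk.1 hz)).eventually (gt_mem_nhds (half_pos hε))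
    have hx : ‖mk A x‖ ≤ Real.sqrt (s + ε) := by
      refine norm_mk_le_of_eventually (Real.sqrt_nonneg _) ?_
      filter_upwards [hlt] with k hk
      refine Real.le_sqrt_of_sq_le ?_
      have h1 : ‖star (x k) * x k‖ = ‖x k‖ * ‖x k‖ := CStarRing.norm_star_mul_self
      have h2 : (z - star x * x) k = z k - star (x k) * x k := rfl
      have h3 : ‖z k‖ ≤ ‖z‖ := lp.norm_apply_le_norm ENNReal.top_ne_zero z k
      have h4 : ‖star (x k) * x k‖ ≤ ‖z k‖ + ‖z k - star (x k) * x k‖ := by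
        simpa using norm_sub_le (z k) (z k - star (x k) * x k)
      rw [h2] at hk
      rw [sq, ← h1]
      linarith
    calc ‖mk A x‖ * ‖mk A x‖ ≤ Real.sqrt (s + ε) * Real.sqrt (s + ε) := by gcongr
      _ = s + ε := Real.mul_self_sqrt (by positivity)

/-- `∏ₖ A k / ∑ₖ A k` is a C⋆-algebra. -/
instance : NonUnitalCStarAlgebra (Corona A) where

end Corona

end Corona

/-! ### MF algebras -/

section MF

open scoped Matrix.Norms.L2Operator

/-- A C⋆-algebra is an MF algebra if it is separable and embeds (by an injective, hence isometric,
not necessarily unital `*`-homomorphism) into `∏ₖ M_{n k}(ℂ) / ∑ₖ M_{n k}(ℂ)` for some positive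
integers `n k`. Matrices carry the operator norm. -/
def IsMF (A : Type*) [NonUnitalCStarAlgebra A] : Prop :=
  TopologicalSpace.SeparableSpace A ∧
    ∃ n : ℕ → ℕ, (∀ k, 0 < n k) ∧
      ∃ φ : A →⋆ₙₐ[ℂ] Corona (fun k => Matrix (Fin (n k)) (Fin (n k)) ℂ),
        Function.Injective φ

end MF

/-! ### The crossed product by a finite group -/

section CrossedProduct

variable {A G : Type*} [NonUnitalCStarAlgebra A] [Group G]

/-- The underlying space of the crossed product `A ⋊_α G` of a C⋆-algebra `A` by an action `α` of a
finite group `G`: as `G` is finite, all functions `G → A`; `f` stands for the formal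
sum `∑ s, f s · u_s`. It carries the twisted convolution product and involution and the
(full) C⋆-norm defined below. -/
def CrossedProduct (_α : G →* (A ≃⋆ₐ[ℂ] A)) : Type _ := G → A

namespace CrossedProduct

variable {α : G →* (A ≃⋆ₐ[ℂ] A)}

instance : FunLike (CrossedProduct α) G A where
  coe f := f
  coe_injective _ _ h := h

instance : AddCommGroup (CrossedProduct α) := inferInstanceAs (AddCommGroup (G → A))

instance : Module ℂ (CrossedProduct α) := inferInstanceAs (Module ℂ (G → A))

variable (α) in
/-- A function `G → A` as an element of the crossed product. -/
def of : (G → A) ≃ₗ[ℂ] CrossedProduct α := LinearEquiv.refl ℂ (G → A)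

@[simp] theorem of_apply (f : G → A) (s : G) : of α f s = f s := rfl
@[simp] theorem zero_apply (s : G) : (0 : CrossedProduct α) s = 0 := rfl
@[simp] theorem add_apply (f g : CrossedProduct α) (s : G) : (f + g) s = f s + g s := rfl
@[simp] theorem neg_apply (f : CrossedProduct α) (s : G) : (-f) s = -f s := rfl
@[simp] theorem sub_apply (f g : CrossedProduct α) (s : G) : (f - g) s = f s - g s := rfl
@[simp] theorem smul_apply (c : ℂ) (f : CrossedProduct α) (s : G) : (c • f) s = c • f s := rfl

@[ext] theorem ext {f g : CrossedProduct α} (h : ∀ s, f s = g s) : f = g := DFunLike.ext _ _ h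

theorem action_mul (s t : G) (a : A) : α (s * t) a = α s (α t a) := by
  rw [map_mul, StarAlgEquiv.mul_apply]

/-- The involution `f⋆(s) = α_s (f(s⁻¹)⋆)`. -/
instance : Star (CrossedProduct α) where
  star f := of α fun s => α s (star (f s⁻¹))

theorem star_apply (f : CrossedProduct α) (s : G) : star f s = α s (star (f s⁻¹)) := rfl

/-- The regular representation of the crossed product by `G × G` matrices over `A`, that is, by
operators on the Hilbert module `ℓ²(G, A)`. -/
def regular (f : CrossedProduct α) : CStarMatrix G G A :=
  CStarMatrix.ofMatrix fun s t => α s⁻¹ (f (s * t⁻¹))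

theorem regular_apply (f : CrossedProduct α) (s t : G) :
    regular f s t = α s⁻¹ (f (s * t⁻¹)) := rfl

theorem regular_injective : Function.Injective (regular (α := α)) := fun f g h => by
  ext s
  have h1 : regular f s 1 = regular g s 1 := by rw [h]
  simpa [regular_apply] using h1

theorem regular_zero : regular (0 : CrossedProduct α) = 0 := by
  ext s t; simp [regular_apply]

theorem regular_add (f g : CrossedProduct α) : regular (f + g) = regular f + regular g := by
  ext s t; simp [regular_apply]

theorem regular_neg (f : CrossedProduct α) : regular (-f) = -regular f := by
  ext s t; simp [regular_apply]

theorem regular_sub (f g : CrossedProduct α) : regular (f - g) = regular f - regular g := by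
  ext s t; simp [regular_apply]

theorem regular_smul (c : ℂ) (f : CrossedProduct α) : regular (c • f) = c • regular f := by
  ext s t; simp [regular_apply]

theorem regular_star (f : CrossedProduct α) : regular (star f) = star (regular f) := by
  ext s t
  rw [CStarMatrix.star_apply, regular_apply, regular_apply, star_apply, ← action_mul, ← map_star]
  simp

variable [Fintype G]

/-- Twisted convolution `(f * g)(s) = ∑ t, f(t) α_t (g(t⁻¹ s))`. -/
instance : Mul (CrossedProduct α) where
  mul f g := of α fun s => ∑ t, f t * α t (g (t⁻¹ * s))

theorem mul_apply (f g : CrossedProduct α) (s : G) :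
    (f * g) s = ∑ t, f t * α t (g (t⁻¹ * s)) := rfl

theorem regular_mul (f g : CrossedProduct α) : regular (f * g) = regular f * regular g := by
  ext s t
  rw [CStarMatrix.mul_apply, regular_apply, mul_apply, map_sum]
  refine Fintype.sum_equiv ((Equiv.inv G).trans (Equiv.mulRight s)) _ _ fun r => ?_
  simp only [regular_apply, map_mul (α s⁻¹), ← action_mul, Equiv.trans_apply, Equiv.inv_apply,
    Equiv.coe_mulRight]
  simp [mul_assoc]

instance : NonUnitalRing (CrossedProduct α) :=
  { (inferInstance : AddCommGroup (CrossedProduct α)),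
    regular_injective.nonUnitalRing regular regular_zero regular_add regular_mul regular_neg
      regular_sub
      (fun n x => map_nsmul (AddMonoidHom.mk' (regular (α := α)) regular_add) n x)
      (fun n x => map_zsmul (AddMonoidHom.mk' (regular (α := α)) regular_add) n x) with }

instance : StarRing (CrossedProduct α) where
  star_involutive f := regular_injective (by simp [regular_star])
  star_mul f g := regular_injective (by simp [regular_star, regular_mul])
  star_add f g := regular_injective (by simp [regular_star, regular_add])

instance : StarModule ℂ (CrossedProduct α) where
  star_smul c f := regular_injective (by simp [regular_star, regular_smul])

instance : IsScalarTower ℂ (CrossedProduct α) (CrossedProduct α) where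
  smul_assoc c f g := by
    ext s
    simp [mul_apply, Finset.smul_sum, smul_mul_assoc]

instance : SMulCommClass ℂ (CrossedProduct α) (CrossedProduct α) where
  smul_comm c f g := by
    ext s
    simp [mul_apply, Finset.smul_sum, mul_smul_comm]

variable (α) in
/-- The C⋆-seminorms on the convolution algebra that are bounded by the `ℓ¹`-norm. These are the
seminorms `f ↦ ‖π f‖` of the `ℓ¹`-contractive `*`-representations `π`, that is, of the integrated
forms of the covariant representations of `(A, G, α)`. -/
def cstarSeminorms : Set (Seminorm ℂ (CrossedProduct α)) :=
  {p | (∀ f g, p (f * g) ≤ p f * p g) ∧ (∀ f, p (star f * f) = p f ^ 2) ∧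
    ∀ f, p f ≤ ∑ s, ‖f s‖}

/-- The norm of the full crossed product: the enveloping C⋆-norm, which is the supremum of all
C⋆-seminorms. -/
instance : Norm (CrossedProduct α) where
  norm f := sSup ((fun p : Seminorm ℂ (CrossedProduct α) => p f) '' cstarSeminorms α)

theorem bddAbove_cstarSeminorms (f : CrossedProduct α) :
    BddAbove ((fun p : Seminorm ℂ (CrossedProduct α) => p f) '' cstarSeminorms α) :=
  ⟨∑ s, ‖f s‖, by rintro _ ⟨p, hp, rfl⟩; exact hp.2.2 f⟩

theorem le_norm {p : Seminorm ℂ (CrossedProduct α)} (hp : p ∈ cstarSeminorms α)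
    (f : CrossedProduct α) : p f ≤ ‖f‖ :=
  le_csSup (bddAbove_cstarSeminorms f) ⟨p, hp, rfl⟩

theorem norm_nonneg' (f : CrossedProduct α) : 0 ≤ ‖f‖ :=
  Real.sSup_nonneg (by rintro _ ⟨p, -, rfl⟩; exact apply_nonneg p f)

theorem norm_le' {f : CrossedProduct α} {C : ℝ} (hC : 0 ≤ C)
    (h : ∀ p ∈ cstarSeminorms α, p f ≤ C) : ‖f‖ ≤ C :=
  Real.sSup_le (by rintro _ ⟨p, hp, rfl⟩; exact h p hp) hC

theorem norm_le_sum (f : CrossedProduct α) : ‖f‖ ≤ ∑ s, ‖f s‖ :=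
  norm_le' (Finset.sum_nonneg fun _ _ => norm_nonneg _) fun _ hp => hp.2.2 f

section Regular

attribute [local instance] CStarAlgebra.spectralOrder CStarAlgebra.spectralOrderedRing

/-- The regular representation is contractive on the copy of `A` at the identity of `G`. -/
theorem norm_regular_le_of_support_one (f : CrossedProduct α) (hf : ∀ s, s ≠ 1 → f s = 0) :
    ‖regular f‖ ≤ ‖f 1‖ := by
  classical
  let φ : A →⋆ₙₐ[ℂ] CStarMatrix G G A :=
    { toFun a := regular (of α (Pi.single 1 a))
      map_smul' c a := by simp only [Pi.single_smul, map_smul, regular_smul]; rfl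
      map_zero' := by simp only [Pi.single_zero, map_zero, regular_zero]
      map_add' a b := by simp only [Pi.single_add, map_add, regular_add]
      map_mul' a b := by
        rw [← regular_mul]
        congr 1
        ext s
        rw [mul_apply, Finset.sum_eq_single 1 (by intro t _ ht; simp [ht]) (by simp)]
        by_cases hs : s = 1 <;> simp [hs]
      map_star' a := by
        rw [← regular_star]
        congr 1
        ext s
        by_cases hs : s = 1 <;> simp [star_apply, hs] }
  have hfφ : regular f = φ (f 1) := by
    change regular f = regular (of α (Pi.single 1 (f 1)))
    congr 1
    ext s
    by_cases hs : s = 1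
    · simp [hs]
    · simp [hs, hf s hs]
  rw [hfφ]
  exact NonUnitalStarAlgHom.norm_apply_le φ (f 1)

theorem norm_regular_le (f : CrossedProduct α) : ‖regular f‖ ≤ ∑ s, ‖f s‖ := by
  classical
  have key : ∀ (s : G) (a : A), ‖regular (of α (Pi.single s a))‖ ≤ ‖a‖ := fun s a => by
    set x := of α (Pi.single s a) with hx
    have hmul : ∀ t, (x * star x) t = if t = 1 then a * star a else 0 := fun t => by
      rw [mul_apply, Finset.sum_eq_single s (by intro r _ hr; simp [hx, hr]) (by simp)]
      by_cases ht : t = 1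
      · subst ht
        have hs : α s (α s⁻¹ (star a)) = star a := by rw [← action_mul]; simp
        simpa [hx, star_apply] using congrArg (a * ·) hs
      · have : t⁻¹ * s ≠ s := by simpa using ht
        simp [hx, star_apply, this, ht]
    have h1 : ‖regular x‖ * ‖regular x‖ ≤ ‖a‖ * ‖a‖ := by
      rw [← CStarRing.norm_self_mul_star, ← regular_star, ← regular_mul]
      refine (norm_regular_le_of_support_one _ fun t ht => by simp [hmul, ht]).trans ?_
      rw [hmul, if_pos rfl, CStarRing.norm_self_mul_star]
    exact le_of_sq_le_sq (by simpa [sq] using h1) (norm_nonneg a)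
  have hsum : regular f = ∑ s, regular (of α (Pi.single s (f s))) := by
    have h := map_sum (AddMonoidHom.mk' (regular (α := α)) regular_add)
      (fun s => of α (Pi.single s (f s))) Finset.univ
    have h' : f = ∑ s, of α (Pi.single s (f s)) := by
      rw [← map_sum, Finset.univ_sum_single fun s => f s]; rfl
    conv_lhs => rw [h']
    exact h
  rw [hsum]
  exact (norm_sum_le _ _).trans (Finset.sum_le_sum fun s _ => key s (f s))

variable (α) in
/-- The C⋆-seminorm of the regular representation. -/
def regularSeminorm : Seminorm ℂ (CrossedProduct α) :=
  Seminorm.of (fun f => ‖regular f‖) (fun f g => by rw [regular_add]; exact norm_add_le _ _)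
    (fun c f => by rw [regular_smul, norm_smul])

theorem regularSeminorm_mem : regularSeminorm α ∈ cstarSeminorms α := by
  refine ⟨fun f g => ?_, fun f => ?_, norm_regular_le⟩
  · change ‖regular (f * g)‖ ≤ ‖regular f‖ * ‖regular g‖
    rw [regular_mul]
    exact norm_mul_le _ _
  · change ‖regular (star f * f)‖ = ‖regular f‖ ^ 2
    rw [regular_mul, regular_star, CStarRing.norm_star_mul_self, sq]

theorem norm_apply_le_norm (f : CrossedProduct α) (s : G) : ‖f s‖ ≤ ‖f‖ := by
  have h1 : regular f 1 s⁻¹ = f s := by simp [regular_apply]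
  calc ‖f s‖ = ‖regular f 1 s⁻¹‖ := by rw [h1]
    _ ≤ ‖regular f‖ := CStarMatrix.norm_entry_le_norm
    _ ≤ ‖f‖ := le_norm regularSeminorm_mem f

end Regular

theorem normedSpaceCore : NormedSpace.Core ℂ (CrossedProduct α) where
  norm_nonneg := norm_nonneg'
  norm_smul c f := by
    have h : ∀ (c : ℂ) (f : CrossedProduct α), ‖c • f‖ ≤ ‖c‖ * ‖f‖ := fun c f =>
      norm_le' (mul_nonneg (norm_nonneg c) (norm_nonneg' f)) fun p hp => by
        rw [map_smul_eq_mul]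
        exact mul_le_mul_of_nonneg_left (le_norm hp f) (norm_nonneg c)
    refine le_antisymm (h c f) ?_
    rcases eq_or_ne c 0 with rfl | hc
    · simpa using norm_nonneg' ((0 : ℂ) • f)
    · have h2 := h c⁻¹ (c • f)
      rw [smul_smul, inv_mul_cancel₀ hc, one_smul, norm_inv] at h2
      rwa [← le_inv_mul_iff₀ (norm_pos_iff.2 hc)]
  norm_triangle f g := norm_le' (add_nonneg (norm_nonneg' f) (norm_nonneg' g)) fun p hp =>
    (map_add_le_add p f g).trans (add_le_add (le_norm hp f) (le_norm hp g))
  norm_eq_zero_iff f := by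
    refine ⟨fun h => ?_, fun h => ?_⟩
    · ext s
      exact norm_le_zero_iff.1 (h ▸ norm_apply_le_norm f s)
    · subst h
      exact le_antisymm ((norm_le_sum _).trans (by simp)) (norm_nonneg' _)

instance : NormedAddCommGroup (CrossedProduct α) := NormedAddCommGroup.ofCore normedSpaceCore

instance : NormedSpace ℂ (CrossedProduct α) := NormedSpace.ofCore normedSpaceCore

instance : NonUnitalNormedRing (CrossedProduct α) where
  dist_eq := NormedAddCommGroup.dist_eq
  norm_mul_le f g := norm_le' (mul_nonneg (norm_nonneg f) (norm_nonneg g)) fun p hp =>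
    (hp.1 f g).trans (mul_le_mul (le_norm hp f) (le_norm hp g) (apply_nonneg p g) (norm_nonneg f))

instance : CStarRing (CrossedProduct α) where
  norm_mul_self_le f := by
    have h : ‖f‖ ≤ Real.sqrt ‖star f * f‖ := norm_le' (Real.sqrt_nonneg _) fun p hp =>
      Real.le_sqrt_of_sq_le ((hp.2.1 f).symm.le.trans (le_norm hp _))
    calc ‖f‖ * ‖f‖ ≤ Real.sqrt ‖star f * f‖ * Real.sqrt ‖star f * f‖ := by gcongr
      _ = ‖star f * f‖ := Real.mul_self_sqrt (norm_nonneg _)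

instance : CompleteSpace (CrossedProduct α) := by
  let e : CrossedProduct α →ₗ[ℂ] (G → A) := (of α).symm.toLinearMap
  have hanti : AntilipschitzWith (Fintype.card G) e :=
    AddMonoidHomClass.antilipschitz_of_bound e fun f => by
      refine (norm_le_sum f).trans ?_
      refine (Finset.sum_le_card_nsmul Finset.univ _ ‖e f‖ fun s _ =>
        norm_le_pi_norm (e f) s).trans ?_
      simp
  have hlip : LipschitzWith 1 e :=
    AddMonoidHomClass.lipschitz_of_bound_nnnorm e 1 fun f => by
      rw [one_mul]
      exact (pi_norm_le_iff_of_nonneg (norm_nonneg f)).2 fun s => norm_apply_le_norm f s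
  have hui : IsUniformInducing e := hanti.isUniformInducing hlip.uniformContinuous
  refine hui.completeSpace ?_
  have : Set.range e = Set.univ := (of α).symm.surjective.range_eq
  rw [this]
  exact isComplete_univ

/-- The crossed product `A ⋊_α G` is a C⋆-algebra. -/
instance : NonUnitalCStarAlgebra (CrossedProduct α) where

section Reduced

attribute [local instance] CStarAlgebra.spectralOrder CStarAlgebra.spectralOrderedRing

/-- The full norm agrees with the norm of the regular representation on `ℓ²(G, A)`: the full and
the reduced crossed product coincide. -/
theorem norm_eq_norm_regular (f : CrossedProduct α) : ‖f‖ = ‖regular f‖ :=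
  let φ : CrossedProduct α →⋆ₙₐ[ℂ] CStarMatrix G G A :=
    { toFun := regular
      map_smul' := regular_smul
      map_zero' := regular_zero
      map_add' := regular_add
      map_mul' := regular_mul
      map_star' := regular_star }
  (NonUnitalStarAlgHom.norm_map φ regular_injective f).symm

end Reduced

end CrossedProduct

end CrossedProduct

end

/-! As `G` is finite, the regular representation `CrossedProduct.regular` is an injective
`*`-homomorphism from the crossed product into the `G × G` matrices over `A`. Applying an embedding
`φ` of `A` into a corona of matrix algebras to each entry gives `G × G` matrices over `∏ₖ M_{n k} /
∑ₖ M_{n k}`. Finite matrices commute with bounded products and with passing to the quotient, and `G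
× G` matrices over `M_{n k}` are the matrices of size `|G| * n k`, so the target is again a corona
of matrix algebras.

The identification is made concrete by isometries `V s` with orthogonal ranges: entries `x s t` are
assembled into `∑ V s * x s t * (V t)ᴴ`. The key fact is `Corona.blockSeq_mem_nullSequences`: such a
sequence is null exactly when all its entries are. `Corona.exists_starHom_of_entries` deduces both
well-definedness and injectivity from it. Only an injective algebraic `*`-homomorphism is required,
so no C⋆-norm on matrices over the corona enters. -/

section BlockMatrices

open scoped Matrix.Norms.L2Operator Matrix

/-! ### Isometries with orthogonal ranges -/

/-- A family of isometries `V s : ℂⁿ → ℂᵐ` with pairwise orthogonal ranges. -/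
def Matrix.IsOrthogonalIsometries {ι p q : Type*} [Fintype p] [Fintype q] [DecidableEq ι]
    [DecidableEq q] (V : ι → Matrix p q ℂ) : Prop :=
  ∀ s t, (V s)ᴴ * V t = if s = t then 1 else 0

namespace Matrix.IsOrthogonalIsometries

variable {ι p q : Type*} [Fintype p] [Fintype q] [DecidableEq ι] [DecidableEq q]
  {V : ι → Matrix p q ℂ}

/-- The orthogonality relation in right-associated form, for rewriting products normalised by
`Matrix.mul_assoc`. -/
theorem conjTranspose_mul_mul (hV : IsOrthogonalIsometries V) (s t : ι) {l : Type*}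
    (x : Matrix q l ℂ) : (V s)ᴴ * (V t * x) = if s = t then x else 0 := by
  rw [← Matrix.mul_assoc, hV s t]
  split_ifs <;> simp

/-- By the C⋆-identity, `‖V s‖² = ‖(V s)ᴴ * V s‖ = ‖1‖`. -/
theorem norm_le_one (hV : IsOrthogonalIsometries V) (s : ι) : ‖V s‖ ≤ 1 := by
  have h := l2_opNorm_conjTranspose_mul_self (V s)
  rw [hV s s, if_pos rfl] at h
  -- Only an inequality: `q` may be empty, and then the norm is `0`.
  have h1 : ‖(1 : Matrix q q ℂ)‖ ≤ 1 := by
    rw [← diagonal_one, l2_opNorm_diagonal]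
    exact (pi_norm_le_iff_of_nonneg zero_le_one).2 fun i => by simp
  nlinarith [norm_nonneg (V s)]

variable [DecidableEq p]

theorem norm_mul_mul_conjTranspose_le (hV : IsOrthogonalIsometries V) (s t : ι)
    (x : Matrix q q ℂ) : ‖V s * x * (V t)ᴴ‖ ≤ ‖x‖ :=
  calc ‖V s * x * (V t)ᴴ‖ ≤ ‖V s‖ * ‖x‖ * ‖(V t)ᴴ‖ :=
        (l2_opNorm_mul _ _).trans (by gcongr; exact l2_opNorm_mul _ _)
    _ ≤ 1 * ‖x‖ * 1 := by
        rw [l2_opNorm_conjTranspose]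
        gcongr
        exacts [hV.norm_le_one s, hV.norm_le_one t]
    _ = ‖x‖ := by ring

theorem norm_conjTranspose_mul_mul_le (hV : IsOrthogonalIsometries V) (s t : ι)
    (y : Matrix p p ℂ) : ‖(V s)ᴴ * y * V t‖ ≤ ‖y‖ :=
  calc ‖(V s)ᴴ * y * V t‖ ≤ ‖(V s)ᴴ‖ * ‖y‖ * ‖V t‖ :=
        (l2_opNorm_mul _ _).trans (by gcongr; exact l2_opNorm_mul _ _)
    _ ≤ 1 * ‖y‖ * 1 := by
        rw [l2_opNorm_conjTranspose]
        gcongr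
        exacts [hV.norm_le_one s, hV.norm_le_one t]
    _ = ‖y‖ := by ring

end Matrix.IsOrthogonalIsometries

/-- `V s` is the inclusion of the `s`-th summand of `⨁_ι ℂⁿ`, that is, the columns of the identity
matrix indexed by `e (s, ·)`. -/
theorem Matrix.exists_isOrthogonalIsometries (ι : Type*) [Fintype ι] [DecidableEq ι] (n : ℕ) :
    ∃ V : ι → Matrix (Fin (Fintype.card ι * n)) (Fin n) ℂ, IsOrthogonalIsometries V := by
  have e : ι × Fin n ≃ Fin (Fintype.card ι * n) := Fintype.equivFinOfCardEq (by simp)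
  refine ⟨fun s => (1 : Matrix _ _ ℂ).submatrix id fun j => e (s, j), fun s t => ?_⟩
  -- The product is the submatrix of the identity with rows `e (s, ·)` and columns `e (t, ·)`;
  -- injectivity of `e` decides its entries.
  rw [conjTranspose_submatrix, conjTranspose_one,
    submatrix_mul _ _ _ id _ Function.bijective_id |>.symm, Matrix.one_mul]
  ext i j
  by_cases hst : s = t <;> simp [Matrix.one_apply, hst]

/-! ### Calculus of block matrices -/

/-- The block matrix with entries `x s t`, with respect to a family of isometries `V`. -/
def Matrix.block {ι p q : Type*} [Fintype ι] [Fintype q]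
    (V : ι → Matrix p q ℂ) (x : ι → ι → Matrix q q ℂ) : Matrix p p ℂ :=
  ∑ s, ∑ t, V s * x s t * (V t)ᴴ

namespace Matrix

variable {ι p q : Type*} [Fintype ι] [Fintype q] {V : ι → Matrix p q ℂ}

theorem block_add (x y : ι → ι → Matrix q q ℂ) : block V (x + y) = block V x + block V y := by
  simp [block, Matrix.mul_add, Matrix.add_mul, Finset.sum_add_distrib]

theorem block_smul (c : ℂ) (x : ι → ι → Matrix q q ℂ) : block V (c • x) = c • block V x := by
  simp [block, Finset.smul_sum]

theorem conjTranspose_block (x : ι → ι → Matrix q q ℂ) :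
    (block V x)ᴴ = block V fun s t => (x t s)ᴴ := by
  simp only [block, conjTranspose_sum, conjTranspose_mul, conjTranspose_conjTranspose,
    Matrix.mul_assoc]
  exact Finset.sum_comm

variable [Fintype p] [DecidableEq ι] [DecidableEq q]

theorem IsOrthogonalIsometries.conjTranspose_mul_block (hV : IsOrthogonalIsometries V)
    (x : ι → ι → Matrix q q ℂ) (s : ι) : (V s)ᴴ * block V x = ∑ t, x s t * (V t)ᴴ := by
  simp only [block, Matrix.mul_sum, Matrix.mul_assoc, hV.conjTranspose_mul_mul]
  rw [Finset.sum_eq_single s (by intro r _ hr; simp [hr.symm]) (by simp)]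
  simp

theorem IsOrthogonalIsometries.block_mul (hV : IsOrthogonalIsometries V)
    (x y : ι → ι → Matrix q q ℂ) :
    block V x * block V y = block V fun s t => ∑ r, x s r * y r t := by
  rw [block, Matrix.sum_mul]
  simp only [Matrix.sum_mul, Matrix.mul_assoc, hV.conjTranspose_mul_block]
  simp only [block, Matrix.sum_mul, Matrix.mul_sum, Matrix.mul_assoc]
  exact Finset.sum_congr rfl fun s _ => Finset.sum_comm

/-- The entries can be recovered by compression; since compression is contractive, this yields
`norm_le_norm_block`. -/
theorem IsOrthogonalIsometries.compress_block (hV : IsOrthogonalIsometries V)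
    (x : ι → ι → Matrix q q ℂ) (s t : ι) : (V s)ᴴ * block V x * V t = x s t := by
  rw [hV.conjTranspose_mul_block, Matrix.sum_mul,
    Finset.sum_eq_single t (by intro r _ hr; simp [Matrix.mul_assoc, hV r t, hr]) (by simp)]
  simp [Matrix.mul_assoc, hV t t]

variable [DecidableEq p]

/-- A crude bound suffices: it does not depend on the matrix sizes, so it is uniform along a
sequence of block matrices. -/
theorem IsOrthogonalIsometries.norm_block_le (hV : IsOrthogonalIsometries V)
    (x : ι → ι → Matrix q q ℂ) : ‖block V x‖ ≤ ∑ s, ∑ t, ‖x s t‖ :=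
  (norm_sum_le _ _).trans <| Finset.sum_le_sum fun s _ => (norm_sum_le _ _).trans <|
    Finset.sum_le_sum fun t _ => hV.norm_mul_mul_conjTranspose_le s t _

theorem IsOrthogonalIsometries.norm_le_norm_block (hV : IsOrthogonalIsometries V)
    (x : ι → ι → Matrix q q ℂ) (s t : ι) : ‖x s t‖ ≤ ‖block V x‖ := by
  rw [← hV.compress_block x s t]
  exact hV.norm_conjTranspose_mul_mul_le s t _

end Matrix

/-! ### Block matrices over the corona -/

namespace Corona

open Matrix

variable {ι : Type*} [Fintype ι] [DecidableEq ι] {m n : ℕ → ℕ}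
  {V : ∀ k, ι → Matrix (Fin (m k)) (Fin (n k)) ℂ}

/-- The block matrices of bounded sequences of matrices. -/
def blockSeq (hV : ∀ k, IsOrthogonalIsometries (V k))
    (x : ι → ι → lp (fun k => Matrix (Fin (n k)) (Fin (n k)) ℂ) ∞) :
    lp (fun k => Matrix (Fin (m k)) (Fin (m k)) ℂ) ∞ :=
  ⟨fun k => block (V k) fun s t => x s t k, memℓp_infty ⟨∑ s, ∑ t, ‖x s t‖, by
    rintro _ ⟨k, rfl⟩
    refine ((hV k).norm_block_le _).trans ?_
    gcongr
    exact lp.norm_apply_le_norm ENNReal.top_ne_zero _ k⟩⟩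

variable (hV : ∀ k, IsOrthogonalIsometries (V k))
  (x y : ι → ι → lp (fun k => Matrix (Fin (n k)) (Fin (n k)) ℂ) ∞)

theorem blockSeq_apply (k : ℕ) : blockSeq hV x k = block (V k) fun s t => x s t k := rfl

theorem blockSeq_add : blockSeq hV (x + y) = blockSeq hV x + blockSeq hV y :=
  lp.ext <| funext fun _ => block_add _ _

theorem blockSeq_smul (c : ℂ) : blockSeq hV (c • x) = c • blockSeq hV x :=
  lp.ext <| funext fun _ => block_smul _ _

theorem blockSeq_sub : blockSeq hV (x - y) = blockSeq hV x - blockSeq hV y := by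
  rw [eq_sub_iff_add_eq, ← blockSeq_add, sub_add_cancel]

theorem blockSeq_star : star (blockSeq hV x) = blockSeq hV fun s t => star (x t s) :=
  lp.ext <| funext fun _ => conjTranspose_block _

theorem blockSeq_mul :
    blockSeq hV x * blockSeq hV y = blockSeq hV fun s t => ∑ r, x s r * y r t :=
  lp.ext <| funext fun k => by
    refine ((hV k).block_mul _ _).trans ?_
    rw [blockSeq_apply]
    congr 1
    ext1 s
    ext1 t
    rw [lp.coeFn_sum, Finset.sum_apply]
    rfl

/-- Each entry is dominated in norm by the block matrix, and the block matrix by the finite sum of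
the norms of its entries. -/
theorem blockSeq_mem_nullSequences :
    blockSeq hV x ∈ nullSequences (fun k => Matrix (Fin (m k)) (Fin (m k)) ℂ) ↔
      ∀ s t, x s t ∈ nullSequences (fun k => Matrix (Fin (n k)) (Fin (n k)) ℂ) := by
  simp only [mem_nullSequences]
  refine ⟨fun h s t => squeeze_zero (fun _ => norm_nonneg _)
    (fun k => (hV k).norm_le_norm_block (fun s t => x s t k) s t) h, fun h => ?_⟩
  refine squeeze_zero (fun _ => norm_nonneg _) (fun k => (hV k).norm_block_le _) ?_
  simpa using tendsto_finsetSum Finset.univ fun s _ =>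
    tendsto_finsetSum Finset.univ fun t _ => h s t

/-- Right to left, the class of the block sequence does not depend on the lifts of the entries; left
to right, it determines their classes. -/
theorem mk_blockSeq_eq_mk_blockSeq :
    mk _ (blockSeq hV x) = mk _ (blockSeq hV y) ↔ ∀ s t, mk _ (x s t) = mk _ (y s t) := by
  simp only [mk_eq_mk, ← blockSeq_sub, blockSeq_mem_nullSequences, Pi.sub_apply]

/-- A `*`-homomorphism into `ι × ι` matrices over `∏ₖ M_{n k} / ∑ₖ M_{n k}`, given by its entries,
as a `*`-homomorphism into `∏ₖ M_{m k} / ∑ₖ M_{m k}`, where `ℂ^{m k}` contains the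
`ι`-fold orthogonal sum of `ℂ^{n k}`. -/
theorem exists_starHom_of_entries {B : Type*} [NonUnitalCStarAlgebra B]
    (hV : ∀ k, IsOrthogonalIsometries (V k))
    (F : B → ι → ι → Corona (fun k => Matrix (Fin (n k)) (Fin (n k)) ℂ))
    (hinj : Function.Injective F)
    (hsmul : ∀ (c : ℂ) f s t, F (c • f) s t = c • F f s t)
    (hadd : ∀ f g s t, F (f + g) s t = F f s t + F g s t)
    (hmul : ∀ f g s t, F (f * g) s t = ∑ r, F f s r * F g r t)
    (hstar : ∀ f s t, F (star f) s t = star (F f t s)) :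
    ∃ ψ : B →⋆ₙₐ[ℂ] Corona (fun k => Matrix (Fin (m k)) (Fin (m k)) ℂ),
      Function.Injective ψ := by
  -- The lifts are arbitrary and need not be linear, multiplicative or `*`-preserving. Every
  -- identity below is checked on the classes of the entries, where `hL` replaces lifts by `F`.
  choose L hL using fun f s t => mk_surjective (F f s t)
  have hadd' : ∀ f g, mk _ (blockSeq hV (L (f + g))) =
      mk _ (blockSeq hV (L f)) + mk _ (blockSeq hV (L g)) := fun f g => by
    rw [← map_add, ← blockSeq_add, mk_blockSeq_eq_mk_blockSeq]
    intro s t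
    rw [Pi.add_apply, Pi.add_apply, map_add, hL, hL, hL, hadd]
  refine ⟨{ toFun f := mk _ (blockSeq hV (L f))
            map_smul' c f := ?_
            -- Additivity at `0 + 0` gives `ψ 0 = ψ 0 + ψ 0`.
            map_zero' := by simpa using hadd' 0 0
            map_add' := hadd'
            map_mul' f g := ?_
            map_star' f := ?_ }, fun f g h => hinj ?_⟩
  · change _ = c • mk _ _
    rw [← map_smul, ← blockSeq_smul, mk_blockSeq_eq_mk_blockSeq]
    intro s t
    rw [Pi.smul_apply, Pi.smul_apply, map_smul, hL, hL, hsmul]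
  · rw [← mk_mul, blockSeq_mul, mk_blockSeq_eq_mk_blockSeq]
    intro s t
    simp only [map_sum, mk_mul, hL, hmul]
  · rw [← mk_star, blockSeq_star, mk_blockSeq_eq_mk_blockSeq]
    intro s t
    simp only [mk_star, hL, hstar]
  · have h' := (mk_blockSeq_eq_mk_blockSeq hV _ _).1 h
    ext s t
    rw [← hL, ← hL, h']

end Corona

end BlockMatrices

/-! ### Separability of the crossed product -/

namespace CrossedProduct

variable {A G : Type*} [NonUnitalCStarAlgebra A] [Group G] [Fintype G] {α : G →* (A ≃⋆ₐ[ℂ] A)}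

/-- The full norm is at most the `ℓ¹`-norm, hence at most `|G|` times the sup norm on `G → A`. -/
theorem continuous_of : Continuous (of α) := by
  refine (LinearMap.mkContinuousOfExistsBound (of α).toLinearMap
    ⟨Fintype.card G, fun f => (norm_le_sum _).trans ?_⟩).continuous
  refine (Finset.sum_le_card_nsmul Finset.univ _ ‖f‖ fun s _ => norm_le_pi_norm f s).trans ?_
  simp

instance [TopologicalSpace.SeparableSpace A] :
    TopologicalSpace.SeparableSpace (CrossedProduct α) :=
  (of α).surjective.denseRange.separableSpace continuous_of

end CrossedProduct

/-! ### The crossed product is MF -/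

theorem theorem4p1 {A : Type*} [NonUnitalCStarAlgebra A] {G : Type*} [Group G] [Fintype G]
    (α : G →* (A ≃⋆ₐ[ℂ] A)) (hA : IsMF A) : IsMF (CrossedProduct α) := by
  classical
  obtain ⟨hsep, n, hn, φ, hφ⟩ := hA
  choose V hV using fun k => Matrix.exists_isOrthogonalIsometries G (n k)
  refine ⟨inferInstance, fun k => Fintype.card G * n k,
    fun k => Nat.mul_pos Fintype.card_pos (hn k), ?_⟩
  -- The entries of the regular representation, pushed through `φ`; the remaining goals are
  -- injectivity and the matrix identities.
  refine Corona.exists_starHom_of_entries hV (fun f s t => φ (CrossedProduct.regular f s t))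
    (fun f g h => CrossedProduct.regular_injective ?_) (fun c f s t => ?_) (fun f g s t => ?_)
    (fun f g s t => ?_) (fun f s t => ?_)
  · ext s t
    exact hφ (congrFun (congrFun h s) t)
  · rw [CrossedProduct.regular_smul, CStarMatrix.smul_apply, map_smul]
  · rw [CrossedProduct.regular_add, CStarMatrix.add_apply, map_add]
  · rw [CrossedProduct.regular_mul, CStarMatrix.mul_apply, map_sum]
    simp only [map_mul]
  · rw [CrossedProduct.regular_star, CStarMatrix.star_apply, map_star]
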